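/- Let $p\in(0,1)$, $s\in(0,1]$, $\beta\in[0,1)$ and let $\pi^*$ be a permutation of $[n]=\{1,\dots,n\}$. Let $G_0$ be an Erdős–Rényi graph $\mathcal G(n,p)$ on $[n]$. The graph $G_1$ is obtained by keeping each edge of $G_0$ independently with probability $s$; the graph $G_2$ is obtained by repeating the same sampling from $G_0$ independently and then relabelling each vertex $u$ as $\pi^*(u)$. Independently of the graphs, the seed mapping $\pi$ is drawn uniformly from the permutations $\sigma$ of $[n]$ with $\sigma(u)=\pi^*(u)$ for exactly $\beta n$ vertices $u$ (it is assumed that such permutations exist). Let $A_1$ and $B_1$ be the adjacency matrices of $G_1$ and $G_2$, let $\Pi$ be the permutation matrix with $\Pi(u,v)=1$ if $\pi(u)=v$ and $\Pi(u,v)=0$ otherwise, and let $W_1=A_1\Pi B_1$, so that $W_1(u,v)$ is the number of $1$-hop witnesses of $(u,v)$. The $1$-hop algorithm outputs the mapping $\tilde\pi$ found by greedy maximum weight matching with weights $W_1$: starting from all pairs $(u,v)\in[n]\times[n]$, repeatedly choose a remaining pair $(u,v)$ of largest weight (ties broken arbitrarily), set $\tilde\pi(u)=v$, and remove all pairs that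 share their first or their second entry with it. There is an absolute constant $N$ such that for all $n\ge N$ and all $p,s,\beta,\pi^*$ as above with $$\beta\ \ge\ \max\left\{\frac{45\log n}{np(1-p)^2s^2},\ 30\sqrt{\frac{\log n}{n(1-p)^2s^2}}\right\},$$ with probability at least $1-n^{-1}$ the $1$-hop algorithm outputs $\tilde\pi=\pi^*$, whatever the tie-breaking rule. -/

import Mathlib

open MeasureTheory ProbabilityTheory

namespace SeededMatching

noncomputable section

/-! ### The correlated random graphs and the seeds -/

/-- All sets of permutations of the finite set `Fin n` are events. -/
instance permMeasurableSpace (n : ℕ) : MeasurableSpace (Equiv.Perm (Fin n)) := ⊤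

/-- The possible seed mappings: the permutations that agree with `πstar` on exactly `β n`
vertices. -/
def seedPerms {n : ℕ} (πstar : Equiv.Perm (Fin n)) (β : ℝ) : Set (Equiv.Perm (Fin n)) :=
  {σ | ((Finset.univ.filter fun u => σ u = πstar u).card : ℝ) = β * n}

/-- A sample point `(G₀, S₁, S₂, π)`: the parent graph, the outcomes of the two rounds of edge
sampling (a pair of vertices is an edge of `Sᵢ` if its coin of the `i`-th round says "keep"), and
the seed mapping. -/
abbrev Sample (n : ℕ) : Type :=
  SimpleGraph (Fin n) × SimpleGraph (Fin n) × SimpleGraph (Fin n) × Equiv.Perm (Fin n)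

/-- The law of the model. The four components are independent; the parent graph is Erdős–Rényi
with edge probability `p`, each coin says "keep" with probability `s`, independently over all
pairs of vertices, and the seed mapping is uniform on `seedPerms πstar β`. -/
def law {n : ℕ} (p s : unitInterval) (πstar : Equiv.Perm (Fin n)) (β : ℝ) :
    Measure (Sample n) :=
  (SimpleGraph.binomialRandom (Fin n) p).prod
    ((SimpleGraph.binomialRandom (Fin n) s).prod
      ((SimpleGraph.binomialRandom (Fin n) s).prod (uniformOn (seedPerms πstar β))))

/-- The graph `G₁`: the edges of the parent graph that are kept in the first round. -/
def graph₁ {n : ℕ} (ω : Sample n) : SimpleGraph (Fin n) :=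
  ω.1 ⊓ ω.2.1

/-- The graph `G₂`: the edges of the parent graph that are kept in the second round, after
relabelling each vertex `u` as `πstar u`. -/
def graph₂ {n : ℕ} (πstar : Equiv.Perm (Fin n)) (ω : Sample n) : SimpleGraph (Fin n) :=
  (ω.1 ⊓ ω.2.2.1).map πstar

/-- The seed mapping `π`. -/
def seed {n : ℕ} (ω : Sample n) : Equiv.Perm (Fin n) :=
  ω.2.2.2

/-! ### The algorithm -/

open scoped Classical in
/-- The `j`-hop adjacency matrix of `G`: its `(u, v)` entry is `1` if the length of a shortest
path from `u` to `v` is `j`, and `0` otherwise (also if there is no path). -/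
def hopMatrix {n : ℕ} (G : SimpleGraph (Fin n)) (j : ℕ) : Matrix (Fin n) (Fin n) ℕ :=
  Matrix.of fun u v => if G.edist u v = (j : ℕ∞) then 1 else 0

/-- The matrix `Wⱼ = Aⱼ Π Bⱼ` of the numbers of `j`-hop witnesses. The permutation matrix `Π` has
entry `1` at `(u, v)` if and only if `π u = v`. -/
def witnessMatrix {n : ℕ} (G₁ G₂ : SimpleGraph (Fin n)) (π : Equiv.Perm (Fin n)) (j : ℕ) :
    Matrix (Fin n) (Fin n) ℕ :=
  hopMatrix G₁ j * π.permMatrix ℕ * hopMatrix G₂ j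

/-- The runs of greedy maximum weight matching with weights `w`. `GreedyRun w E l` says that,
started with the set `E` of candidate pairs, the procedure can choose successively the pairs in
the list `l`: at each step it chooses a candidate of largest weight (ties may be broken in any
way) and removes every candidate that shares a vertex with it, until no candidate is left. -/
inductive GreedyRun {n : ℕ} (w : Matrix (Fin n) (Fin n) ℕ) :
    Finset (Fin n × Fin n) → List (Fin n × Fin n) → Prop
  | done : GreedyRun w ∅ []
  | pick (E : Finset (Fin n × Fin n)) (e : Fin n × Fin n) (l : List (Fin n × Fin n))
      (mem : e ∈ E) (isMax : ∀ e' ∈ E, w e'.1 e'.2 ≤ w e.1 e.2)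
      (rest : GreedyRun w (E.filter fun e' => e'.1 ≠ e.1 ∧ e'.2 ≠ e.2) l) :
      GreedyRun w E (e :: l)

/-- The mapping `f` is a possible output of greedy maximum weight matching on the complete
bipartite graph with weights `w`: some run chooses exactly the pairs `(u, f u)`. -/
def IsGMWMOutput {n : ℕ} (w : Matrix (Fin n) (Fin n) ℕ) (f : Fin n → Fin n) : Prop :=
  ∃ l : List (Fin n × Fin n), GreedyRun w Finset.univ l ∧ ∀ u v, (u, v) ∈ l ↔ f u = v

/-- The mapping `f` is a possible output of the `j`-hop algorithm on the input `G₁`, `G₂`, `π`. -/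
def IsHopOutput {n : ℕ} (j : ℕ) (G₁ G₂ : SimpleGraph (Fin n)) (π : Equiv.Perm (Fin n))
    (f : Fin n → Fin n) : Prop :=
  IsGMWMOutput (witnessMatrix G₁ G₂ π j) f

/-- The event that the `j`-hop algorithm outputs the true mapping `πstar`, however ties are
broken: `πstar` is a possible output and it is the only one. -/
def exactRecovery {n : ℕ} (j : ℕ) (πstar : Equiv.Perm (Fin n)) : Set (Sample n) :=
  {ω | ∀ f : Fin n → Fin n,
    IsHopOutput j (graph₁ ω) (graph₂ πstar ω) (seed ω) f ↔ f = πstar}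

end

end SeededMatching

/-! Put `σ = πstar⁻¹ * π`. A vertex `w` is a witness of `(u, πstar v)` when `u w` survives the first
sampling and `v (σ w)` the second. If `v = u` and `w` is a seed, both are the same parent edge, so
the probability is `p s²`; otherwise two parent edges are needed and it is `p² s²`. Up to boundary
terms, the mean for a correct pair thus exceeds that for a wrong pair by `D = n β p s² (1 - p)`.

The hypothesis on `β` makes `D` dominate the fluctuations (`gapBounds_of_le`). Chernoff bounds need
independence. It holds among seeds, and for a wrong pair once two vertices are dropped. Non-seeds of
a correct pair can share a parent edge along the cycles of `σ`, so they are split by a 3-colouring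
of `σ` (`exists_coloring_of_perm`). A union bound over at most `5 n²` events of probability at most
`n ^ (-3.2)` shows that each correct pair strictly beats its row
(`measureReal_exists_witnessCount_ge`). Row dominance alone forces greedy matching to return `πstar`
(`isGMWMOutput_iff_eq`). The estimate is uniform in the seed mapping, which is averaged out at the
end. -/

namespace SeededMatching

/-! ### Chernoff bounds for sums of independent indicators -/

section Chernoff

variable {Ω ι : Type*} [MeasurableSpace Ω] {μ : Measure Ω} [Fintype ι] {B : ι → Set Ω}

/-- Independence factors the moment generating function, and `1 + x ≤ exp x` bounds each Bernoulli
factor by the Poisson one. -/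
theorem mgf_sum_indicator_le [IsProbabilityMeasure μ] (hB : ∀ i, MeasurableSet (B i))
    (hind : iIndepSet B μ) (t : ℝ) :
    mgf (∑ i, (B i).indicator fun _ => (1 : ℝ)) μ t
      ≤ Real.exp ((∑ i, μ.real (B i)) * (Real.exp t - 1)) := by
  have hfun : iIndepFun (fun i => (B i).indicator fun _ => (1 : ℝ)) μ :=
    hind.iIndepFun_indicator
  rw [hfun.mgf_sum (fun i => measurable_const.indicator (hB i)), Finset.sum_mul, Real.exp_sum]
  refine Finset.prod_le_prod (fun i _ => mgf_nonneg) fun i _ => ?_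
  have hexp : (fun ω => Real.exp (t * (B i).indicator (fun _ => (1 : ℝ)) ω))
      = fun ω => 1 + (B i).indicator (fun _ => Real.exp t - 1) ω := by
    funext ω
    by_cases h : ω ∈ B i <;> simp [h]
  have hval : mgf ((B i).indicator fun _ => (1 : ℝ)) μ t
      = μ.real (B i) * (Real.exp t - 1) + 1 := by
    rw [mgf, hexp, integral_add (integrable_const _)
      ((integrable_const _).indicator (hB i)), integral_indicator_const _ (hB i)]
    simp [add_comm]
  rw [hval]
  exact Real.add_one_le_exp _

theorem integrable_exp_mul_sum_indicator [IsProbabilityMeasure μ]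
    (hB : ∀ i, MeasurableSet (B i)) (hind : iIndepSet B μ) (t : ℝ) :
    Integrable (fun ω => Real.exp (t * (∑ i, (B i).indicator fun _ => (1 : ℝ)) ω)) μ := by
  have hfun : iIndepFun (fun i => (B i).indicator fun _ => (1 : ℝ)) μ :=
    hind.iIndepFun_indicator
  refine hfun.integrable_exp_mul_sum (fun i => measurable_const.indicator (hB i)) fun i _ => ?_
  have hexp : (fun ω => Real.exp (t * (B i).indicator (fun _ => (1 : ℝ)) ω))
      = fun ω => 1 + (B i).indicator (fun _ => Real.exp t - 1) ω := by
    funext ω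
    by_cases h : ω ∈ B i <;> simp [h]
  rw [hexp]
  exact (integrable_const _).add ((integrable_const _).indicator (hB i))

theorem exp_neg_sub_one_le {x : ℝ} (hx : 0 ≤ x) : Real.exp (-x) - 1 ≤ -x + x ^ 2 / 2 := by
  have h := Real.quadratic_le_exp_of_nonneg hx
  have hpos : 0 < 1 + x + x ^ 2 / 2 := by positivity
  have h1 : Real.exp (-x) ≤ (1 + x + x ^ 2 / 2)⁻¹ := by
    rw [Real.exp_neg]
    exact inv_anti₀ hpos h
  have h2 : (1 + x + x ^ 2 / 2)⁻¹ ≤ 1 - x + x ^ 2 / 2 := by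
    rw [inv_le_iff_one_le_mul₀ hpos]
    -- The product `(1 - x + x²/2) (1 + x + x²/2)` equals `1 + x⁴/4`.
    nlinarith [sq_nonneg (x ^ 2)]
  linarith

/-- Lower tail: the number of events that occur is rarely below its mean by `δ` or more. -/
theorem measureReal_sum_indicator_le [IsProbabilityMeasure μ]
    (hB : ∀ i, MeasurableSet (B i)) (hind : iIndepSet B μ) {m t δ : ℝ} (ht : 0 ≤ t)
    (hm : ∑ i, μ.real (B i) ≤ m) :
    μ.real {ω | ∑ i, (B i).indicator (fun _ => (1 : ℝ)) ω ≤ ∑ i, μ.real (B i) - δ}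
      ≤ Real.exp (m * t ^ 2 / 2 - t * δ) := by
  have h := measure_le_le_exp_mul_mgf (∑ i, μ.real (B i) - δ) (neg_nonpos.2 ht)
    (integrable_exp_mul_sum_indicator hB hind (-t))
  simp only [Finset.sum_apply] at h
  refine h.trans ((mul_le_mul_of_nonneg_left (mgf_sum_indicator_le hB hind (-t))
    (Real.exp_pos _).le).trans ?_)
  rw [← Real.exp_add, Real.exp_le_exp]
  have h0 : 0 ≤ ∑ i, μ.real (B i) := Finset.sum_nonneg fun _ _ => measureReal_nonneg
  nlinarith [mul_le_mul_of_nonneg_left (exp_neg_sub_one_le ht) h0,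
    mul_le_mul_of_nonneg_right hm (sq_nonneg t)]

/-- Upper tail: the number of events that occur is rarely above its mean by `δ` or more. -/
theorem measureReal_le_sum_indicator [IsProbabilityMeasure μ]
    (hB : ∀ i, MeasurableSet (B i)) (hind : iIndepSet B μ) {m t δ : ℝ} (ht : 0 ≤ t) (ht1 : t ≤ 1)
    (hm : ∑ i, μ.real (B i) ≤ m) :
    μ.real {ω | m + δ ≤ ∑ i, (B i).indicator (fun _ => (1 : ℝ)) ω}
      ≤ Real.exp (m * t ^ 2 - t * δ) := by
  have h := measure_ge_le_exp_mul_mgf (m + δ) ht (integrable_exp_mul_sum_indicator hB hind t)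
  simp only [Finset.sum_apply] at h
  refine h.trans ((mul_le_mul_of_nonneg_left (mgf_sum_indicator_le hB hind t)
    (Real.exp_pos _).le).trans ?_)
  rw [← Real.exp_add, Real.exp_le_exp]
  -- This is `exp t - 1 ≤ t + t²`, the reason for requiring `t ≤ 1`.
  have h1 := (abs_le.1 (Real.abs_exp_sub_one_sub_id_le (abs_le.2 ⟨by linarith, ht1⟩))).2
  have h2 : 0 ≤ Real.exp t - 1 := by linarith [Real.add_one_le_exp t]
  have h0 : 0 ≤ ∑ i, μ.real (B i) := Finset.sum_nonneg fun _ _ => measureReal_nonneg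
  nlinarith [mul_le_mul_of_nonneg_right hm h2, mul_le_mul_of_nonneg_left h1 (h0.trans hm)]

end Chernoff

/-! ### Edge sets of the three independent random graphs -/

section Edges

variable {V : Type*} [Finite V]

/-- Together with finiteness this makes every set of graphs an event. -/
instance : MeasurableSingletonClass (SimpleGraph V) where
  measurableSet_singleton G := by
    have h := (MeasurableSet.singleton G.edgeSet).preimage
      (SimpleGraph.measurable_edgeSet (V := V))
    convert h using 1
    ext H
    simp

instance : Finite (SimpleGraph V) :=
  Finite.of_injective _ SimpleGraph.edgeSet_injective

theorem binomialRandom_superset (p : unitInterval) (F : Finset (Sym2 V))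
    (hF : ∀ e ∈ F, ¬ e.IsDiag) :
    (SimpleGraph.binomialRandom V p).real {G | ↑F ⊆ G.edgeSet} = (p : ℝ) ^ F.card := by
  classical
  rw [SimpleGraph.binomialRandom_eq_map, measureReal_def,
    Measure.map_apply (by fun_prop) (Set.toFinite _).measurableSet, setBernoulli_apply']
  have hset : (fun q : Sym2 V → Prop => {i | q i}) ⁻¹'
      (SimpleGraph.fromEdgeSet ⁻¹' {G : SimpleGraph V | ↑F ⊆ G.edgeSet})
      = Set.pi ↑F fun _ => {True} := by
    ext q
    simp only [Set.mem_preimage, Set.mem_ofPred_eq, SimpleGraph.edgeSet_fromEdgeSet,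
      Set.mem_pi, Set.mem_singleton_iff, Finset.mem_coe, eq_iff_iff, iff_true, Set.subset_def,
      Set.mem_sdiff]
    exact forall₂_congr fun e he => ⟨fun h => h.1, fun h => ⟨h, hF e he⟩⟩
  rw [hset, Measure.infinitePi_pi _ (fun _ _ => by measurability), ENNReal.toReal_prod]
  rw [Finset.prod_congr rfl (g := fun _ => (p : ℝ)), Finset.prod_const]
  intro e he
  simp [hF e he]

/-- The joint law of the parent graph and of the two rounds of edge sampling. -/
noncomputable def graphLaw (V : Type*) (p s : unitInterval) :
    Measure (SimpleGraph V × SimpleGraph V × SimpleGraph V) :=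
  (SimpleGraph.binomialRandom V p).prod
    ((SimpleGraph.binomialRandom V s).prod (SimpleGraph.binomialRandom V s))

instance (p s : unitInterval) : IsProbabilityMeasure (graphLaw V p s) := by
  unfold graphLaw; infer_instance

/-- The event that the three graphs contain the edges `F.1`, `F.2.1` and `F.2.2`, respectively. -/
def containsEdges (F : Finset (Sym2 V) × Finset (Sym2 V) × Finset (Sym2 V)) :
    Set (SimpleGraph V × SimpleGraph V × SimpleGraph V) :=
  {ω | ↑F.1 ⊆ ω.1.edgeSet ∧ ↑F.2.1 ⊆ ω.2.1.edgeSet ∧ ↑F.2.2 ⊆ ω.2.2.edgeSet}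

theorem graphLaw_containsEdges (p s : unitInterval)
    (F : Finset (Sym2 V) × Finset (Sym2 V) × Finset (Sym2 V))
    (h0 : ∀ e ∈ F.1, ¬ e.IsDiag) (h1 : ∀ e ∈ F.2.1, ¬ e.IsDiag) (h2 : ∀ e ∈ F.2.2, ¬ e.IsDiag) :
    (graphLaw V p s).real (containsEdges F)
      = (p : ℝ) ^ F.1.card * ((s : ℝ) ^ F.2.1.card * (s : ℝ) ^ F.2.2.card) := by
  have hset : containsEdges F = {G | ↑F.1 ⊆ G.edgeSet} ×ˢ
      ({G | ↑F.2.1 ⊆ G.edgeSet} ×ˢ {G | ↑F.2.2 ⊆ G.edgeSet}) := by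
    ext ω; rfl
  rw [hset, graphLaw, measureReal_prod_prod, measureReal_prod_prod, binomialRandom_superset p _ h0,
    binomialRandom_superset s _ h1, binomialRandom_superset s _ h2]

/-- An intersection of containment events is the containment event of the unions, and disjointness
makes the exponents add up. It is needed only within each graph, since the three graphs are
independent. -/
theorem iIndepSet_containsEdges {ι : Type*} (p s : unitInterval)
    (F : ι → Finset (Sym2 V) × Finset (Sym2 V) × Finset (Sym2 V))
    (h0 : ∀ i, ∀ e ∈ (F i).1, ¬ e.IsDiag) (h1 : ∀ i, ∀ e ∈ (F i).2.1, ¬ e.IsDiag)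
    (h2 : ∀ i, ∀ e ∈ (F i).2.2, ¬ e.IsDiag)
    (d0 : Pairwise fun i j => Disjoint (F i).1 (F j).1)
    (d1 : Pairwise fun i j => Disjoint (F i).2.1 (F j).2.1)
    (d2 : Pairwise fun i j => Disjoint (F i).2.2 (F j).2.2) :
    iIndepSet (fun i => containsEdges (F i)) (graphLaw V p s) := by
  classical
  rw [iIndepSet_iff_meas_biInter fun i => (Set.toFinite _).measurableSet]
  intro S
  have hinter : ⋂ i ∈ S, containsEdges (F i) = containsEdges
      (S.biUnion fun i => (F i).1, S.biUnion fun i => (F i).2.1, S.biUnion fun i => (F i).2.2) := by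
    ext ω
    simp only [containsEdges, Set.mem_iInter, Set.mem_ofPred_eq, Finset.coe_biUnion,
      Set.iUnion_subset_iff, Finset.mem_coe]
    exact ⟨fun h => ⟨fun i hi => (h i hi).1, fun i hi => (h i hi).2.1, fun i hi => (h i hi).2.2⟩,
      fun h i hi => ⟨h.1 i hi, h.2.1 i hi, h.2.2 i hi⟩⟩
  rw [hinter, ← ENNReal.toReal_eq_toReal_iff' (measure_ne_top _ _)
    (ENNReal.prod_ne_top fun _ _ => measure_ne_top _ _), ENNReal.toReal_prod]
  simp only [← measureReal_def]
  rw [graphLaw_containsEdges p s]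
  · rw [Finset.prod_congr rfl fun i _ => graphLaw_containsEdges p s (F i) (h0 i) (h1 i) (h2 i)]
    simp only [Finset.prod_mul_distrib, Finset.prod_pow_eq_pow_sum]
    rw [Finset.card_biUnion fun i _ j _ hij => d0 hij, Finset.card_biUnion fun i _ j _ hij => d1 hij,
      Finset.card_biUnion fun i _ j _ hij => d2 hij]
  all_goals
    intro e he
    obtain ⟨i, -, hi⟩ := Finset.mem_biUnion.1 he
    first | exact h0 i e hi | exact h1 i e hi | exact h2 i e hi

end Edges

/-! ### Greedy matching under row dominance -/

section Greedy

variable {n : ℕ} {w : Matrix (Fin n) (Fin n) ℕ} {ρ : Equiv.Perm (Fin n)}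

/-- If `E` contains the correct pair of every first entry, a maximal candidate is correct. -/
theorem eq_of_isMax (hw : ∀ u v, v ≠ ρ u → w u v < w u (ρ u)) {E : Finset (Fin n × Fin n)}
    (hE : ∀ e ∈ E, (e.1, ρ e.1) ∈ E) {e : Fin n × Fin n} (he : e ∈ E)
    (hmax : ∀ e' ∈ E, w e'.1 e'.2 ≤ w e.1 e.2) : e.2 = ρ e.1 := by
  by_contra h
  exact absurd (hmax _ (hE e he)) (not_le.2 (hw _ _ h))

/-- Removing a correct pair removes no other correct pair, because `ρ` is injective; the invariant
of the greedy procedure persists. -/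
theorem mem_filter_of_closed {E : Finset (Fin n × Fin n)} (hE : ∀ e ∈ E, (e.1, ρ e.1) ∈ E)
    {e : Fin n × Fin n} (he : e.2 = ρ e.1) :
    ∀ e' ∈ E.filter fun e' => e'.1 ≠ e.1 ∧ e'.2 ≠ e.2,
      (e'.1, ρ e'.1) ∈ E.filter fun e' => e'.1 ≠ e.1 ∧ e'.2 ≠ e.2 := by
  intro e' he'
  rw [Finset.mem_filter] at he' ⊢
  refine ⟨hE e' he'.1, he'.2.1, ?_⟩
  rw [he]
  exact fun h => he'.2.1 (ρ.injective h)

theorem GreedyRun.eq_of_mem (hw : ∀ u v, v ≠ ρ u → w u v < w u (ρ u))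
    {E : Finset (Fin n × Fin n)} {l : List (Fin n × Fin n)} (h : GreedyRun w E l)
    (hE : ∀ e ∈ E, (e.1, ρ e.1) ∈ E) : ∀ e ∈ l, e.2 = ρ e.1 := by
  induction h with
  | done => simp
  | pick E e l mem isMax rest ih =>
    have he := eq_of_isMax hw hE mem isMax
    intro e' he'
    rcases List.mem_cons.1 he' with rfl | he'
    · exact he
    · exact ih (mem_filter_of_closed hE he) e' he'

theorem exists_greedyRun (hw : ∀ u v, v ≠ ρ u → w u v < w u (ρ u)) (k : ℕ) :
    ∀ E : Finset (Fin n × Fin n), E.card ≤ k → (∀ e ∈ E, (e.1, ρ e.1) ∈ E) →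
      ∃ l, GreedyRun w E l ∧ ∀ u, (u, ρ u) ∈ E → (u, ρ u) ∈ l := by
  induction k with
  | zero =>
    intro E hcard _
    obtain rfl : E = ∅ := Finset.card_eq_zero.1 (Nat.le_zero.1 hcard)
    exact ⟨[], .done, by simp⟩
  | succ k ih =>
    intro E hcard hE
    rcases E.eq_empty_or_nonempty with rfl | hne
    · exact ⟨[], .done, by simp⟩
    obtain ⟨e, he, hmax⟩ := E.exists_max_image (fun e => w e.1 e.2) hne
    have hρ := eq_of_isMax hw hE he hmax
    have hlt : (E.filter fun e' => e'.1 ≠ e.1 ∧ e'.2 ≠ e.2).card < E.card :=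
      Finset.card_lt_card (Finset.filter_ssubset.2 ⟨e, he, by simp⟩)
    obtain ⟨l, hl, hmem⟩ := ih _ (by omega) (mem_filter_of_closed hE hρ)
    refine ⟨e :: l, .pick E e l he hmax hl, fun u hu => ?_⟩
    by_cases hue : u = e.1
    · subst hue
      rw [← hρ]
      exact List.mem_cons_self
    · refine List.mem_cons_of_mem _ (hmem u (Finset.mem_filter.2 ⟨hu, hue, ?_⟩))
      rw [hρ]
      exact fun h => hue (ρ.injective h)

/-- Column maxima are irrelevant: a globally heaviest candidate is heaviest in its row, and the
row's correct pair is still available. -/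
theorem isGMWMOutput_iff_eq (hw : ∀ u v, v ≠ ρ u → w u v < w u (ρ u)) (f : Fin n → Fin n) :
    IsGMWMOutput w f ↔ f = ρ := by
  have huniv : ∀ e ∈ (Finset.univ : Finset (Fin n × Fin n)), (e.1, ρ e.1) ∈ Finset.univ :=
    fun _ _ => Finset.mem_univ _
  constructor
  · rintro ⟨l, hl, hf⟩
    funext u
    exact hl.eq_of_mem hw huniv _ ((hf u (f u)).2 rfl)
  · rintro rfl
    obtain ⟨l, hl, hmem⟩ := exists_greedyRun hw _ Finset.univ le_rfl huniv
    refine ⟨l, hl, fun u v => ⟨fun h => (hl.eq_of_mem hw huniv _ h).symm, ?_⟩⟩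
    rintro rfl
    exact hmem u (Finset.mem_univ _)

end Greedy

/-! ### Witnesses -/

open scoped Classical in
/-- The number of `1`-hop witnesses of `(u, πstar v)`, in terms of the permutation
`σ = πstar⁻¹ ∘ π` and of the graphs before the relabelling. -/
noncomputable def witnessCount {n : ℕ}
    (ω : SimpleGraph (Fin n) × SimpleGraph (Fin n) × SimpleGraph (Fin n))
    (σ : Equiv.Perm (Fin n)) (u v : Fin n) : ℕ :=
  (Finset.univ.filter fun w => (ω.1 ⊓ ω.2.1).Adj u w ∧ (ω.1 ⊓ ω.2.2).Adj v (σ w)).card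

theorem witnessMatrix_apply {n : ℕ} (ω : Sample n) (πstar : Equiv.Perm (Fin n)) (u v : Fin n) :
    witnessMatrix (graph₁ ω) (graph₂ πstar ω) (seed ω) 1 u (πstar v)
      = witnessCount (ω.1, ω.2.1, ω.2.2.1) (πstar⁻¹ * ω.2.2.2) u v := by
  classical
  have hhop : ∀ (G : SimpleGraph (Fin n)) (a b : Fin n),
      hopMatrix G 1 a b = if G.Adj a b then 1 else 0 := by
    intro G a b
    simp [hopMatrix, SimpleGraph.edist_eq_one_iff_adj]
  have hadj : ∀ x, (graph₂ πstar ω).Adj x (πstar v) ↔ (ω.1 ⊓ ω.2.2.1).Adj v (πstar⁻¹ x) := by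
    intro x
    rw [graph₂, SimpleGraph.map_adj']
    constructor
    · rintro ⟨-, a, b, hab, rfl, hb⟩
      obtain rfl := πstar.injective hb
      simpa using hab.symm
    · intro h
      refine ⟨fun hx => ?_, _, _, h.symm, by simp, rfl⟩
      subst hx
      simp at h
  rw [witnessMatrix, Matrix.mul_apply, witnessCount, Finset.card_filter]
  have hrow : ∀ x, (hopMatrix (graph₁ ω) 1 * (seed ω).permMatrix ℕ) u x
      = hopMatrix (graph₁ ω) 1 u ((seed ω).symm x) := by
    intro x
    rw [PEquiv.mul_toMatrix_toPEquiv]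
    rfl
  -- Reindexing by `π` lets the sum run over the vertices of `G₁`.
  rw [← Equiv.sum_comp (seed ω)]
  refine Finset.sum_congr rfl fun x _ => ?_
  rw [hrow, hhop, hhop]
  simp only [hadj, Equiv.symm_apply_apply, graph₁, seed, Equiv.Perm.mul_apply]
  by_cases h₁ : (ω.1 ⊓ ω.2.1).Adj u x <;>
    by_cases h₂ : (ω.1 ⊓ ω.2.2.1).Adj v (πstar⁻¹ (ω.2.2.2 x)) <;>
    simp only [h₁, h₂, and_self, and_true, and_false, if_true, if_false, mul_one, mul_zero]

theorem mem_exactRecovery_of_witnessCount_lt {n : ℕ} (πstar : Equiv.Perm (Fin n)) (ω : Sample n)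
    (h : ∀ u v, v ≠ u → witnessCount (ω.1, ω.2.1, ω.2.2.1) (πstar⁻¹ * ω.2.2.2) u v
      < witnessCount (ω.1, ω.2.1, ω.2.2.1) (πstar⁻¹ * ω.2.2.2) u u) :
    ω ∈ exactRecovery 1 πstar := by
  refine isGMWMOutput_iff_eq fun u v hv => ?_
  obtain ⟨x, rfl⟩ := πstar.surjective v
  rw [witnessMatrix_apply, witnessMatrix_apply]
  exact h u x fun hxu => hv (by rw [hxu])

/-- Colour the points one at a time: a new point `a` has at most the two neighbours `σ a` and `σ⁻¹
a`, so one of three colours is free. -/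
theorem exists_coloring_of_perm {α : Type*} [Fintype α] (σ : Equiv.Perm α) :
    ∃ c : α → Fin 3, ∀ x, σ x ≠ x → c (σ x) ≠ c x := by
  classical
  suffices h : ∀ S : Finset α, ∃ c : α → Fin 3,
      ∀ x ∈ S, σ x ∈ S → σ x ≠ x → c (σ x) ≠ c x by
    obtain ⟨c, hc⟩ := h Finset.univ
    exact ⟨c, fun x => hc x (Finset.mem_univ _) (Finset.mem_univ _)⟩
  intro S
  induction S using Finset.induction_on with
  | empty => exact ⟨fun _ => 0, by simp⟩
  | insert a S ha ih =>
    obtain ⟨c, hc⟩ := ih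
    have hfresh : ∀ i j : Fin 3, ∃ k, k ≠ i ∧ k ≠ j := by decide
    obtain ⟨k, hk1, hk2⟩ := hfresh (c (σ a)) (c (σ⁻¹ a))
    refine ⟨Function.update c a k, fun x hx hσx hne => ?_⟩
    by_cases hxa : x = a
    · subst hxa
      simpa [Function.update_of_ne hne] using hk1.symm
    · by_cases hσ : σ x = a
      · have : x = σ⁻¹ a := by rw [← hσ]; simp
        rw [Function.update_of_ne hxa, hσ, Function.update_self, this]
        exact hk2
      · rw [Function.update_of_ne hxa, Function.update_of_ne hσ]
        exact hc x (Finset.mem_of_mem_insert_of_ne hx hxa)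
          (Finset.mem_of_mem_insert_of_ne hσx hσ) hne

section Witnesses

variable {n : ℕ}

open scoped Classical in
/-- The number of witnesses of `(u, πstar v)` in the set `C`. -/
noncomputable def witnessCountOn
    (ω : SimpleGraph (Fin n) × SimpleGraph (Fin n) × SimpleGraph (Fin n))
    (σ : Equiv.Perm (Fin n)) (u v : Fin n) (C : Finset (Fin n)) : ℕ :=
  (C.filter fun w => (ω.1 ⊓ ω.2.1).Adj u w ∧ (ω.1 ⊓ ω.2.2).Adj v (σ w)).card

/-- The edges that make `w` a witness of `(u, πstar v)`. -/
def witnessEdges (σ : Equiv.Perm (Fin n)) (u v w : Fin n) :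
    Finset (Sym2 (Fin n)) × Finset (Sym2 (Fin n)) × Finset (Sym2 (Fin n)) :=
  ({s(u, w), s(v, σ w)}, {s(u, w)}, {s(v, σ w)})

theorem mem_containsEdges_witnessEdges {σ : Equiv.Perm (Fin n)} {u v w : Fin n}
    {ω : SimpleGraph (Fin n) × SimpleGraph (Fin n) × SimpleGraph (Fin n)} :
    ω ∈ containsEdges (witnessEdges σ u v w)
      ↔ (ω.1 ⊓ ω.2.1).Adj u w ∧ (ω.1 ⊓ ω.2.2).Adj v (σ w) := by
  simp only [containsEdges, witnessEdges, Set.mem_ofPred_eq, Finset.coe_insert,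
    Finset.coe_singleton, Set.insert_subset_iff, Set.singleton_subset_iff,
    SimpleGraph.mem_edgeSet, SimpleGraph.inf_adj]
  tauto

theorem sum_indicator_witnessEdges (σ : Equiv.Perm (Fin n)) (u v : Fin n) (C : Finset (Fin n))
    (ω : SimpleGraph (Fin n) × SimpleGraph (Fin n) × SimpleGraph (Fin n)) :
    ∑ w : C, (containsEdges (witnessEdges σ u v w)).indicator (fun _ => (1 : ℝ)) ω
      = witnessCountOn ω σ u v C := by
  classical
  rw [Finset.sum_coe_sort C
    fun w => (containsEdges (witnessEdges σ u v w)).indicator (fun _ => (1 : ℝ)) ω,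
    witnessCountOn, Finset.card_filter]
  push_cast
  refine Finset.sum_congr rfl fun w _ => ?_
  rw [Set.indicator_apply]
  exact if_congr mem_containsEdges_witnessEdges rfl rfl

/-- The conditions under which the members of `C` are independently witnesses of `(u, πstar v)`,
each of them requiring `k` edges of the parent graph. -/
structure IndepWitnesses (σ : Equiv.Perm (Fin n)) (u v : Fin n) (C : Finset (Fin n)) (k : ℕ) :
    Prop where
  ne_left : ∀ w ∈ C, w ≠ u
  ne_right : ∀ w ∈ C, σ w ≠ v
  edge_ne : ∀ w ∈ C, ∀ w' ∈ C, w ≠ w' → s(u, w) ≠ s(v, σ w')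
  card_eq : ∀ w ∈ C, ({s(u, w), s(v, σ w)} : Finset (Sym2 (Fin n))).card = k

variable {σ : Equiv.Perm (Fin n)} {u v : Fin n} {C : Finset (Fin n)} {k : ℕ}

theorem IndepWitnesses.sum_measureReal (h : IndepWitnesses σ u v C k) (p s : unitInterval) :
    ∑ w : C, (graphLaw (Fin n) p s).real (containsEdges (witnessEdges σ u v w))
      = C.card * ((p : ℝ) ^ k * (s : ℝ) ^ 2) := by
  have hterm : ∀ w : C, (graphLaw (Fin n) p s).real (containsEdges (witnessEdges σ u v w))
      = (p : ℝ) ^ k * (s : ℝ) ^ 2 := by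
    intro w
    have hu := (h.ne_left w w.2).symm
    have hv := (h.ne_right w w.2).symm
    rw [graphLaw_containsEdges]
    · simp only [witnessEdges, h.card_eq w w.2, Finset.card_singleton]
      ring
    all_goals simp [witnessEdges, hu, hv]
  simp [hterm]

theorem IndepWitnesses.iIndepSet (h : IndepWitnesses σ u v C k) (p s : unitInterval) :
    ProbabilityTheory.iIndepSet (fun w : C => containsEdges (witnessEdges σ u v w))
      (graphLaw (Fin n) p s) := by
  have hu : ∀ w : C, u ≠ w := fun w => (h.ne_left w w.2).symm
  have hv : ∀ w : C, v ≠ σ w := fun w => (h.ne_right w w.2).symm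
  have h1 : ∀ w w' : C, w ≠ w' → s(u, (w : Fin n)) ≠ s(u, (w' : Fin n)) := by
    intro w w' hne he
    exact hne (Subtype.ext (Sym2.congr_right.1 he))
  have h2 : ∀ w w' : C, w ≠ w' → s(v, σ w) ≠ s(v, σ w') := by
    intro w w' hne he
    exact hne (Subtype.ext (σ.injective (Sym2.congr_right.1 he)))
  have h3 : ∀ w w' : C, w ≠ w' → s(u, (w : Fin n)) ≠ s(v, σ w') := fun w w' hne =>
    h.edge_ne w w.2 w' w'.2 fun he => hne (Subtype.ext he)
  refine iIndepSet_containsEdges p s _ ?_ ?_ ?_ ?_ ?_ ?_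
  · simp [witnessEdges, hu, hv]
  · simp [witnessEdges, hu]
  · simp [witnessEdges, hv]
  · intro w w' hne
    simp only [witnessEdges, Finset.disjoint_insert_left, Finset.disjoint_singleton_left,
      Finset.mem_insert, Finset.mem_singleton, not_or]
    exact ⟨⟨h1 w w' hne, h3 w w' hne⟩, (h3 w' w hne.symm).symm, h2 w w' hne⟩
  · intro w w' hne
    simpa [witnessEdges] using h1 w w' hne
  · intro w w' hne
    simpa [witnessEdges] using h2 w w' hne

theorem IndepWitnesses.measureReal_le (h : IndepWitnesses σ u v C k) (p s : unitInterval)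
    {m t δ : ℝ} (ht : 0 ≤ t) (hm : C.card * ((p : ℝ) ^ k * (s : ℝ) ^ 2) ≤ m) :
    (graphLaw (Fin n) p s).real
        {ω | (witnessCountOn ω σ u v C : ℝ) ≤ C.card * ((p : ℝ) ^ k * (s : ℝ) ^ 2) - δ}
      ≤ Real.exp (m * t ^ 2 / 2 - t * δ) := by
  have hs := h.sum_measureReal p s
  have := measureReal_sum_indicator_le (fun w : C => (Set.toFinite _).measurableSet)
    (h.iIndepSet p s) (δ := δ) ht (hs.trans_le hm)
  simpa only [hs, sum_indicator_witnessEdges] using this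

theorem IndepWitnesses.le_measureReal (h : IndepWitnesses σ u v C k) (p s : unitInterval)
    {m t δ : ℝ} (ht : 0 ≤ t) (ht1 : t ≤ 1) (hm : C.card * ((p : ℝ) ^ k * (s : ℝ) ^ 2) ≤ m) :
    (graphLaw (Fin n) p s).real {ω | m + δ ≤ (witnessCountOn ω σ u v C : ℝ)}
      ≤ Real.exp (m * t ^ 2 - t * δ) := by
  have hs := h.sum_measureReal p s
  have := measureReal_le_sum_indicator (fun w : C => (Set.toFinite _).measurableSet)
    (h.iIndepSet p s) (δ := δ) ht ht1 (hs.trans_le hm)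
  simpa only [sum_indicator_witnessEdges] using this

/-! ### The three kinds of witnesses -/

/-- The possible witnesses of the correct pair of `u` that are seeds. -/
def seedWitnesses (σ : Equiv.Perm (Fin n)) (u : Fin n) : Finset (Fin n) :=
  Finset.univ.filter fun w => σ w = w ∧ w ≠ u

/-- The possible witnesses of the correct pair of `u` that are not seeds. -/
def nonseedWitnesses (σ : Equiv.Perm (Fin n)) (u : Fin n) : Finset (Fin n) :=
  Finset.univ.filter fun w => σ w ≠ w ∧ w ≠ u ∧ σ w ≠ u

/-- The possible witnesses of the wrong pair `(u, πstar v)`, up to at most two. -/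
def wrongWitnesses (σ : Equiv.Perm (Fin n)) (u v : Fin n) : Finset (Fin n) :=
  Finset.univ.filter fun w => (w ≠ u ∧ σ w ≠ v) ∧ w ≠ v ∧ σ w ≠ u

/-- The two parent edges of a seed coincide; the resulting `k = 1` is the source of the gap. -/
theorem indepWitnesses_seedWitnesses (σ : Equiv.Perm (Fin n)) (u : Fin n) :
    IndepWitnesses σ u u (seedWitnesses σ u) 1 := by
  have hmem : ∀ w ∈ seedWitnesses σ u, σ w = w ∧ w ≠ u := fun w hw => by
    simpa [seedWitnesses] using hw
  refine ⟨fun w hw => (hmem w hw).2, fun w hw => ?_, fun w hw w' hw' hne he => ?_, fun w hw => ?_⟩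
  · rw [(hmem w hw).1]; exact (hmem w hw).2
  · rw [(hmem w' hw').1] at he
    exact hne (Sym2.congr_right.1 he)
  · simp [(hmem w hw).1]

/-- A shared edge `u w = u (σ w')` forces `w = σ w'`, which is impossible within one colour class.
-/
theorem indepWitnesses_nonseedWitnesses (σ : Equiv.Perm (Fin n)) (u : Fin n) {c : Fin n → Fin 3}
    (hc : ∀ x, σ x ≠ x → c (σ x) ≠ c x) (i : Fin 3) :
    IndepWitnesses σ u u ((nonseedWitnesses σ u).filter fun w => c w = i) 2 := by
  have hmem : ∀ w ∈ (nonseedWitnesses σ u).filter fun w => c w = i,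
      (σ w ≠ w ∧ w ≠ u ∧ σ w ≠ u) ∧ c w = i := fun w hw => by
    simpa [nonseedWitnesses] using hw
  refine ⟨fun w hw => (hmem w hw).1.2.1, fun w hw => (hmem w hw).1.2.2,
    fun w hw w' hw' _ he => ?_, fun w hw => ?_⟩
  · have h := Sym2.congr_right.1 he
    refine hc w' (hmem w' hw').1.1 ?_
    rw [← h, (hmem w hw).2, (hmem w' hw').2]
  · exact Finset.card_pair fun he => (hmem w hw).1.1 (Sym2.congr_right.1 he).symm

/-- The edges at `u` and at `v` can only meet in the edge `u v`, which is excluded. -/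
theorem indepWitnesses_wrongWitnesses (σ : Equiv.Perm (Fin n)) {u v : Fin n} (huv : u ≠ v) :
    IndepWitnesses σ u v (wrongWitnesses σ u v) 2 := by
  have hmem : ∀ w ∈ wrongWitnesses σ u v, (w ≠ u ∧ σ w ≠ v) ∧ w ≠ v ∧ σ w ≠ u := fun w hw => by
    simpa [wrongWitnesses] using hw
  have hne : ∀ w ∈ wrongWitnesses σ u v, ∀ x, s(u, w) ≠ s(v, x) := by
    intro w hw x he
    rcases Sym2.eq_iff.1 he with h | h
    · exact huv h.1
    · exact (hmem w hw).2.1 h.2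
  exact ⟨fun w hw => (hmem w hw).1.1, fun w hw => (hmem w hw).1.2,
    fun w hw w' _ _ => hne w hw _, fun w hw => Finset.card_pair (hne w hw _)⟩

/-! ### Boundary terms in the counts -/

theorem card_seedWitnesses_le (σ : Equiv.Perm (Fin n)) (u : Fin n) :
    (seedWitnesses σ u).card ≤ (Finset.univ.filter fun w => σ w = w).card :=
  Finset.card_le_card fun w hw => by
    simp only [seedWitnesses, Finset.mem_filter] at hw ⊢
    exact ⟨hw.1, hw.2.1⟩

theorem le_card_seedWitnesses (σ : Equiv.Perm (Fin n)) (u : Fin n) :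
    (Finset.univ.filter fun w => σ w = w).card ≤ (seedWitnesses σ u).card + 1 := by
  have hsub : (Finset.univ.filter fun w => σ w = w) ⊆ seedWitnesses σ u ∪ {u} := by
    intro w hw
    by_cases h : w = u <;> simp_all [seedWitnesses]
  exact (Finset.card_le_card hsub).trans (Finset.card_union_le _ _)

theorem le_card_nonseedWitnesses (σ : Equiv.Perm (Fin n)) (u : Fin n) :
    n ≤ (Finset.univ.filter fun w => σ w = w).card + (nonseedWitnesses σ u).card + 2 := by
  have hsub : (Finset.univ : Finset (Fin n)) ⊆
      ((Finset.univ.filter fun w => σ w = w) ∪ nonseedWitnesses σ u) ∪ {u, σ⁻¹ u} := by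
    intro w _
    by_cases h : w = u
    · simp [h]
    by_cases h' : σ w = u
    · simp [← h']
    by_cases h'' : σ w = w <;> simp [nonseedWitnesses, h, h', h'']
  have h1 := (Finset.card_le_card hsub).trans (Finset.card_union_le _ _)
  have h2 := Finset.card_union_le (Finset.univ.filter fun w => σ w = w) (nonseedWitnesses σ u)
  have h3 : ({u, σ⁻¹ u} : Finset (Fin n)).card ≤ 2 := Finset.card_le_two
  rw [Finset.card_univ, Fintype.card_fin] at h1
  omega

theorem witnessCount_le (ω : SimpleGraph (Fin n) × SimpleGraph (Fin n) × SimpleGraph (Fin n))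
    (σ : Equiv.Perm (Fin n)) (u v : Fin n) :
    witnessCount ω σ u v ≤ witnessCountOn ω σ u v (wrongWitnesses σ u v) + 2 := by
  classical
  -- Only these two vertices may be lost: a witness satisfies `w ≠ u` and `σ w ≠ v` by irreflexivity
  -- of adjacency.
  have h3 : ({v, σ⁻¹ u} : Finset (Fin n)).card ≤ 2 := Finset.card_le_two
  refine le_trans ?_ (Nat.add_le_add_left h3 _)
  rw [witnessCount, witnessCountOn]
  refine le_trans (Finset.card_le_card fun w hw => ?_) (Finset.card_union_le _ _)
  have hw' := (Finset.mem_filter.1 hw).2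
  by_cases hwv : w = v
  · simp [hwv]
  by_cases hwu : σ w = u
  · simp [← hwu]
  · refine Finset.mem_union_left _ (Finset.mem_filter.2 ⟨?_, hw'⟩)
    simp only [wrongWitnesses, Finset.mem_filter, Finset.mem_univ, true_and]
    exact ⟨⟨hw'.1.ne', hw'.2.ne'⟩, hwv, hwu⟩

theorem le_witnessCount (ω : SimpleGraph (Fin n) × SimpleGraph (Fin n) × SimpleGraph (Fin n))
    (σ : Equiv.Perm (Fin n)) (u : Fin n) (c : Fin n → Fin 3) :
    witnessCountOn ω σ u u (seedWitnesses σ u)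
        + ∑ i, witnessCountOn ω σ u u ((nonseedWitnesses σ u).filter fun w => c w = i)
      ≤ witnessCount ω σ u u := by
  classical
  have hfib : ∑ i, witnessCountOn ω σ u u ((nonseedWitnesses σ u).filter fun w => c w = i)
      = witnessCountOn ω σ u u (nonseedWitnesses σ u) := by
    unfold witnessCountOn
    rw [Finset.card_eq_sum_card_fiberwise (f := c) (t := Finset.univ) fun _ _ => by simp]
    refine Finset.sum_congr rfl fun i _ => ?_
    rw [Finset.filter_filter, Finset.filter_filter]
    simp only [and_comm]
  rw [hfib, witnessCountOn, witnessCountOn, witnessCount, ← Finset.card_union_of_disjoint]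
  · refine Finset.card_le_card (Finset.union_subset ?_ ?_) <;>
      exact Finset.filter_subset_filter _ (Finset.subset_univ _)
  · refine Finset.disjoint_filter_filter (Finset.disjoint_left.2 fun w hw hw' => ?_)
    simp only [seedWitnesses, nonseedWitnesses, Finset.mem_filter] at hw hw'
    exact hw'.2.1 hw.2.1

end Witnesses

/-! ### The union bound for a fixed seed mapping -/

/-- The inequalities between the gap `D` of the means, the mean `M` of the number of seed
witnesses, the bound `m` for the means of the other numbers of witnesses, and `ℓ = log n`. -/
structure GapBounds (D M m ℓ : ℝ) : Prop where
  log_large : 10 ≤ ℓ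
  gap_ge : 45 * ℓ ≤ D
  gap_sq_ge_seed : 45 * ℓ * M ≤ D ^ 2
  gap_sq_ge : 900 * ℓ * m ≤ D ^ 2

/-- The first lower bound on `β` says `D (1 - p) ≥ 45 ℓ`. Since `D = M (1 - p)`, it bounds both `D`
and `D² = D (1 - p) M`. Squaring the second one and multiplying by `m` gives the last inequality. -/
theorem gapBounds_of_le {x p s β ℓ : ℝ} (hx : 0 < x) (hp : 0 < p) (hp1 : p < 1) (hs : 0 < s)
    (hβ0 : 0 ≤ β) (hℓ : 10 ≤ ℓ)
    (hβ : max (45 * ℓ / (x * p * (1 - p) ^ 2 * s ^ 2))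
      (30 * Real.sqrt (ℓ / (x * (1 - p) ^ 2 * s ^ 2))) ≤ β) :
    GapBounds (x * β * p * s ^ 2 * (1 - p)) (x * β * p * s ^ 2) (x * p ^ 2 * s ^ 2) ℓ := by
  have hq : 0 < 1 - p := by linarith
  obtain ⟨h1, h2⟩ := max_le_iff.1 hβ
  rw [div_le_iff₀ (by positivity)] at h1
  have hM : 0 ≤ x * β * p * s ^ 2 := by positivity
  have hD : 0 ≤ x * β * p * s ^ 2 * (1 - p) := by positivity
  have h1' : 45 * ℓ ≤ x * β * p * s ^ 2 * (1 - p) * (1 - p) := by linarith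
  refine ⟨hℓ, ?_, ?_, ?_⟩
  · nlinarith
  · nlinarith [mul_le_mul_of_nonneg_right h1' hM]
  · have h3 : 900 * (ℓ / (x * (1 - p) ^ 2 * s ^ 2)) ≤ β ^ 2 := by
      have h0 : 0 ≤ ℓ / (x * (1 - p) ^ 2 * s ^ 2) := by positivity
      have := pow_le_pow_left₀ (by positivity) h2 2
      rw [mul_pow, Real.sq_sqrt h0] at this
      linarith
    rw [← mul_div_assoc, div_le_iff₀ (by positivity)] at h3
    have h4 : 0 ≤ x * p ^ 2 * s ^ 2 := by positivity
    nlinarith [mul_le_mul_of_nonneg_right h3 h4]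

theorem GapBounds.gap_pos {D M m ℓ : ℝ} (h : GapBounds D M m ℓ) : 0 < D := by
  linarith [h.log_large, h.gap_ge]

/-- With `t = κ ℓ / D`, both terms of a Chernoff exponent become multiples of `ℓ`. -/
theorem mul_div_sq_le {A D R ℓ κ : ℝ} (hA : 0 < A) (hD : 0 < D) (hℓ : 0 ≤ ℓ)
    (h : A * ℓ * R ≤ D ^ 2) : R * (κ * ℓ / D) ^ 2 ≤ κ ^ 2 * ℓ / A := by
  rw [div_pow, ← mul_div_assoc, div_le_div_iff₀ (by positivity) hA]
  nlinarith [mul_le_mul_of_nonneg_left h (mul_nonneg (sq_nonneg κ) hℓ)]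

section Union

variable {n : ℕ} {σ : Equiv.Perm (Fin n)} {p s : unitInterval} {D M m ℓ : ℝ}

/-! ### Tail bounds for each kind of witness -/

theorem measureReal_seedWitnesses_le (h : GapBounds D M m ℓ) (u : Fin n)
    (hM : (Finset.univ.filter fun w => σ w = w).card * ((p : ℝ) ^ 1 * (s : ℝ) ^ 2) ≤ M) :
    (graphLaw (Fin n) p s).real {ω | (witnessCountOn ω σ u u (seedWitnesses σ u) : ℝ)
        ≤ (seedWitnesses σ u).card * ((p : ℝ) ^ 1 * (s : ℝ) ^ 2) - 0.38 * D}
      ≤ Real.exp (-(3.2 * ℓ)) := by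
  have hD := h.gap_pos
  have hℓ : 0 ≤ ℓ := by linarith [h.log_large]
  have hp := p.2.1
  have hs := s.2.1
  -- `κ = 17` nearly minimises `κ²/90 - 0.38 κ`, with value below `-3.2`.
  refine ((indepWitnesses_seedWitnesses σ u).measureReal_le p s (m := M) (t := 17 * ℓ / D)
    (by positivity) (le_trans ?_ hM)).trans (Real.exp_le_exp.2 ?_)
  · have := card_seedWitnesses_le σ u
    gcongr
  · have h1 := mul_div_sq_le (κ := 17) (by norm_num) hD hℓ h.gap_sq_ge_seed
    have h2 : 17 * ℓ / D * (0.38 * D) = 17 * ℓ * 0.38 := by field_simp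
    rw [h2]
    linarith

theorem card_mul_le (hm : n * ((p : ℝ) ^ 2 * (s : ℝ) ^ 2) ≤ m) (C : Finset (Fin n)) :
    C.card * ((p : ℝ) ^ 2 * (s : ℝ) ^ 2) ≤ m := by
  refine le_trans ?_ hm
  have : C.card ≤ n := by simpa using Finset.card_le_univ C
  gcongr

theorem measureReal_nonseedWitnesses_le (h : GapBounds D M m ℓ) (u : Fin n)
    (hm : n * ((p : ℝ) ^ 2 * (s : ℝ) ^ 2) ≤ m) {c : Fin n → Fin 3}
    (hc : ∀ x, σ x ≠ x → c (σ x) ≠ c x) (i : Fin 3) :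
    (graphLaw (Fin n) p s).real
        {ω | (witnessCountOn ω σ u u ((nonseedWitnesses σ u).filter fun w => c w = i) : ℝ)
          ≤ ((nonseedWitnesses σ u).filter fun w => c w = i).card * ((p : ℝ) ^ 2 * (s : ℝ) ^ 2)
            - 0.085 * D}
      ≤ Real.exp (-(3.2 * ℓ)) := by
  have hD := h.gap_pos
  have hℓ : 0 ≤ ℓ := by linarith [h.log_large]
  -- `κ = 75` nearly minimises `κ²/1800 - 0.085 κ`, with value `-3.25`.
  refine ((indepWitnesses_nonseedWitnesses σ u hc i).measureReal_le p s (m := m)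
    (t := 75 * ℓ / D) (by positivity) (card_mul_le hm _)).trans (Real.exp_le_exp.2 ?_)
  have h1 := mul_div_sq_le (κ := 75) (by norm_num) hD hℓ h.gap_sq_ge
  have h2 : 75 * ℓ / D * (0.085 * D) = 75 * ℓ * 0.085 := by field_simp
  rw [h2]
  linarith

theorem measureReal_wrongWitnesses_le (h : GapBounds D M m ℓ) {u v : Fin n} (huv : u ≠ v)
    (hm : n * ((p : ℝ) ^ 2 * (s : ℝ) ^ 2) ≤ m) :
    (graphLaw (Fin n) p s).real
        {ω | m + 0.13 * D ≤ (witnessCountOn ω σ u v (wrongWitnesses σ u v) : ℝ)}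
      ≤ Real.exp (-(3.2 * ℓ)) := by
  have hD := h.gap_pos
  have hℓ : 0 ≤ ℓ := by linarith [h.log_large]
  -- `κ = 45` is the largest value for which `gap_ge` ensures `t ≤ 1`; the exponent is then `-3.6
  -- ℓ`.
  refine ((indepWitnesses_wrongWitnesses σ huv).le_measureReal p s (m := m)
    (t := 45 * ℓ / D) (by positivity) ((div_le_one hD).2 h.gap_ge)
    (card_mul_le hm _)).trans (Real.exp_le_exp.2 ?_)
  have h1 := mul_div_sq_le (κ := 45) (by norm_num) hD hℓ h.gap_sq_ge
  have h2 : 45 * ℓ / D * (0.13 * D) = 45 * ℓ * 0.13 := by field_simp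
  rw [h2]
  linarith

theorem witnessCount_lt_of_concentration
    {ω : SimpleGraph (Fin n) × SimpleGraph (Fin n) × SimpleGraph (Fin n)} {u v : Fin n}
    {c : Fin n → Fin 3} {β : ℝ}
    (hcard : ((Finset.univ.filter fun w => σ w = w).card : ℝ) = β * n)
    (h : GapBounds (n * β * p * (s : ℝ) ^ 2 * (1 - p)) (n * β * p * (s : ℝ) ^ 2)
      (n * (p : ℝ) ^ 2 * (s : ℝ) ^ 2) ℓ)
    (hseed : (seedWitnesses σ u).card * ((p : ℝ) ^ 1 * (s : ℝ) ^ 2)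
        - 0.38 * (n * β * p * (s : ℝ) ^ 2 * (1 - p))
      < (witnessCountOn ω σ u u (seedWitnesses σ u) : ℝ))
    (hnon : ∀ i, ((nonseedWitnesses σ u).filter fun w => c w = i).card
        * ((p : ℝ) ^ 2 * (s : ℝ) ^ 2) - 0.085 * (n * β * p * (s : ℝ) ^ 2 * (1 - p))
      < (witnessCountOn ω σ u u ((nonseedWitnesses σ u).filter fun w => c w = i) : ℝ))
    (hwrong : (witnessCountOn ω σ u v (wrongWitnesses σ u v) : ℝ)
      < n * (p : ℝ) ^ 2 * (s : ℝ) ^ 2 + 0.13 * (n * β * p * (s : ℝ) ^ 2 * (1 - p))) :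
    witnessCount ω σ u v < witnessCount ω σ u u := by
  have h1 : (witnessCount ω σ u v : ℝ) ≤ witnessCountOn ω σ u v (wrongWitnesses σ u v) + 2 := by
    exact_mod_cast witnessCount_le ω σ u v
  have h2 : (witnessCountOn ω σ u u (seedWitnesses σ u) : ℝ)
      + ∑ i, (witnessCountOn ω σ u u ((nonseedWitnesses σ u).filter fun w => c w = i) : ℝ)
      ≤ witnessCount ω σ u u := by
    exact_mod_cast le_witnessCount ω σ u c
  have h3 : (β * n : ℝ) ≤ (seedWitnesses σ u).card + 1 := by
    rw [← hcard]
    exact_mod_cast le_card_seedWitnesses σ u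
  have h4 : (n : ℝ) ≤ β * n + ∑ i, (((nonseedWitnesses σ u).filter fun w => c w = i).card : ℝ)
      + 2 := by
    have hfib : (nonseedWitnesses σ u).card
        = ∑ i, ((nonseedWitnesses σ u).filter fun w => c w = i).card :=
      Finset.card_eq_sum_card_fiberwise fun _ _ => by simp
    have := le_card_nonseedWitnesses σ u
    rw [hfib] at this
    rw [← hcard]
    exact_mod_cast this
  simp only [Fin.sum_univ_three] at h2 h4
  have hp0 := p.2.1
  have hs0 := s.2.1
  have hs2 : (s : ℝ) ^ 2 ≤ 1 := pow_le_one₀ hs0 s.2.2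
  have hp2 : (p : ℝ) ^ 2 ≤ 1 := pow_le_one₀ hp0 p.2.2
  have ha0 : 0 ≤ (p : ℝ) ^ 1 * (s : ℝ) ^ 2 := by positivity
  have ha1 : (p : ℝ) ^ 1 * (s : ℝ) ^ 2 ≤ 1 :=
    mul_le_one₀ (pow_le_one₀ hp0 p.2.2) (by positivity) hs2
  have hb0 : 0 ≤ (p : ℝ) ^ 2 * (s : ℝ) ^ 2 := by positivity
  have hb1 : (p : ℝ) ^ 2 * (s : ℝ) ^ 2 ≤ 1 := mul_le_one₀ hp2 (by positivity) hs2
  have h5 := mul_le_mul_of_nonneg_right h3 ha0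
  have h6 := mul_le_mul_of_nonneg_right h4 hb0
  have h7 := hnon 0
  have h8 := hnon 1
  have h9 := hnon 2
  have h10 := h.gap_ge
  have h11 := h.log_large
  have hD : (n * β * p * (s : ℝ) ^ 2 * (1 - p))
      = β * n * ((p : ℝ) ^ 1 * (s : ℝ) ^ 2) - β * n * ((p : ℝ) ^ 2 * (s : ℝ) ^ 2) := by ring
  have hm : n * (p : ℝ) ^ 2 * (s : ℝ) ^ 2 = n * ((p : ℝ) ^ 2 * (s : ℝ) ^ 2) := by ring
  rw [hm] at hwrong
  generalize (n * β * p * (s : ℝ) ^ 2 * (1 - p) : ℝ) = D at *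
  -- The deviations use up `0.38 + 3 * 0.085 + 0.13 = 0.765` of `D`. The remaining `0.235 D` exceeds
  -- 100, while the boundary terms cost at most 5.
  have : (witnessCount ω σ u v : ℝ) < witnessCount ω σ u u := by
    linarith
  exact_mod_cast this

theorem five_mul_sq_mul_exp_le (hn : 10 ≤ Real.log n) :
    5 * (n : ℝ) ^ 2 * Real.exp (-(3.2 * Real.log n)) ≤ 1 / n := by
  have hn0 : (0 : ℝ) < n := by
    rcases Nat.eq_zero_or_pos n with rfl | h
    · norm_num at hn
    · exact_mod_cast h
  rw [le_div_iff₀ hn0]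
  -- `log n ≥ 10` gives exponent at least 2, and `exp 2 ≥ 1 + 2 + 2²/2 = 5`.
  have h5 : (5 : ℝ) ≤ Real.exp (0.2 * Real.log n) := by
    have h := Real.quadratic_le_exp_of_nonneg (x := 2) (by norm_num)
    have h' : Real.exp 2 ≤ Real.exp (0.2 * Real.log n) := Real.exp_le_exp.2 (by linarith)
    linarith
  have h3 : (n : ℝ) ^ 3 = Real.exp (3 * Real.log n) := by
    rw [mul_comm, Real.exp_mul, Real.exp_log hn0]
    norm_cast
  calc 5 * (n : ℝ) ^ 2 * Real.exp (-(3.2 * Real.log n)) * n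
      = 5 * ((n : ℝ) ^ 3 * Real.exp (-(3.2 * Real.log n))) := by ring
    _ ≤ Real.exp (0.2 * Real.log n) * ((n : ℝ) ^ 3 * Real.exp (-(3.2 * Real.log n))) := by
        gcongr
    _ = 1 := by
        rw [h3, ← Real.exp_add, ← Real.exp_add, Real.exp_eq_one_iff]
        ring

theorem measureReal_exists_witnessCount_ge {β : ℝ}
    (hcard : ((Finset.univ.filter fun w => σ w = w).card : ℝ) = β * n)
    (h : GapBounds (n * β * p * (s : ℝ) ^ 2 * (1 - p)) (n * β * p * (s : ℝ) ^ 2)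
      (n * (p : ℝ) ^ 2 * (s : ℝ) ^ 2) (Real.log n)) :
    (graphLaw (Fin n) p s).real
      {ω | ∃ u v, v ≠ u ∧ witnessCount ω σ u u ≤ witnessCount ω σ u v} ≤ 1 / n := by
  obtain ⟨c, hc⟩ := exists_coloring_of_perm σ
  set D := (n * β * p * (s : ℝ) ^ 2 * (1 - p) : ℝ)
  set ε := Real.exp (-(3.2 * Real.log n))
  have hε0 : 0 ≤ ε := (Real.exp_pos _).le
  have hM : (Finset.univ.filter fun w => σ w = w).card * ((p : ℝ) ^ 1 * (s : ℝ) ^ 2)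
      ≤ n * β * p * (s : ℝ) ^ 2 := by
    rw [hcard]; exact le_of_eq (by ring)
  have hm : n * ((p : ℝ) ^ 2 * (s : ℝ) ^ 2) ≤ n * (p : ℝ) ^ 2 * (s : ℝ) ^ 2 :=
    le_of_eq (by ring)
  let S : Fin n → Set (SimpleGraph (Fin n) × SimpleGraph (Fin n) × SimpleGraph (Fin n)) :=
    fun u => {ω | (witnessCountOn ω σ u u (seedWitnesses σ u) : ℝ)
        ≤ (seedWitnesses σ u).card * ((p : ℝ) ^ 1 * (s : ℝ) ^ 2) - 0.38 * D}
  let T : Fin n × Fin 3 → Set (SimpleGraph (Fin n) × SimpleGraph (Fin n) × SimpleGraph (Fin n)) :=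
    fun x => {ω | (witnessCountOn ω σ x.1 x.1
          ((nonseedWitnesses σ x.1).filter fun w => c w = x.2) : ℝ)
          ≤ ((nonseedWitnesses σ x.1).filter fun w => c w = x.2).card
            * ((p : ℝ) ^ 2 * (s : ℝ) ^ 2) - 0.085 * D}
  -- Putting `x.1 ≠ x.2` inside the event makes it empty on the diagonal, so the union can run over
  -- all pairs.
  let U : Fin n × Fin n → Set (SimpleGraph (Fin n) × SimpleGraph (Fin n) × SimpleGraph (Fin n)) :=
    fun x => {ω | x.1 ≠ x.2 ∧ n * (p : ℝ) ^ 2 * (s : ℝ) ^ 2 + 0.13 * D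
      ≤ (witnessCountOn ω σ x.1 x.2 (wrongWitnesses σ x.1 x.2) : ℝ)}
  have hS : ∀ u, (graphLaw (Fin n) p s).real (S u) ≤ ε := fun u =>
    measureReal_seedWitnesses_le h u hM
  have hT : ∀ x, (graphLaw (Fin n) p s).real (T x) ≤ ε := fun x =>
    measureReal_nonseedWitnesses_le h x.1 hm hc x.2
  have hU : ∀ x, (graphLaw (Fin n) p s).real (U x) ≤ ε := by
    rintro ⟨u, v⟩
    by_cases huv : u = v
    · simpa [U, huv] using hε0
    · exact (measureReal_mono fun ω hω => hω.2).trans (measureReal_wrongWitnesses_le h huv hm)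
  have hsub : {ω | ∃ u v, v ≠ u ∧ witnessCount ω σ u u ≤ witnessCount ω σ u v}
      ⊆ ((⋃ u, S u) ∪ ⋃ x, T x) ∪ ⋃ x, U x := by
    rintro ω ⟨u, v, hne, hle⟩
    by_contra hω
    simp only [Set.mem_union, Set.mem_iUnion, not_or, not_exists] at hω
    obtain ⟨⟨hωS, hωT⟩, hωU⟩ := hω
    refine absurd hle (not_le.2 (witnessCount_lt_of_concentration hcard h (c := c)
      (not_le.1 (hωS u)) (fun i => not_le.1 (hωT (u, i))) (not_le.1 fun hw => ?_)))
    exact hωU (u, v) ⟨hne.symm, hw⟩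
  have hsumS : (graphLaw (Fin n) p s).real (⋃ u, S u) ≤ n * ε := by
    refine (measureReal_iUnion_fintype_le _).trans ((Finset.sum_le_sum fun u _ => hS u).trans ?_)
    simp
  have hsumT : (graphLaw (Fin n) p s).real (⋃ x, T x) ≤ n * 3 * ε := by
    refine (measureReal_iUnion_fintype_le _).trans ((Finset.sum_le_sum fun u _ => hT u).trans ?_)
    simp
  have hsumU : (graphLaw (Fin n) p s).real (⋃ x, U x) ≤ n * n * ε := by
    refine (measureReal_iUnion_fintype_le _).trans ((Finset.sum_le_sum fun u _ => hU u).trans ?_)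
    simp
  have hn1 : (1 : ℝ) ≤ n := by
    rcases Nat.eq_zero_or_pos n with rfl | h'
    · have := h.log_large
      norm_num at this
    · exact_mod_cast h'
  calc (graphLaw (Fin n) p s).real
        {ω | ∃ u v, v ≠ u ∧ witnessCount ω σ u u ≤ witnessCount ω σ u v}
      ≤ n * ε + n * 3 * ε + n * n * ε :=
        (measureReal_mono hsub).trans ((measureReal_union_le _ _).trans
          (add_le_add ((measureReal_union_le _ _).trans (add_le_add hsumS hsumT)) hsumU))
    _ = (4 * n + (n : ℝ) ^ 2) * ε := by ring
    _ ≤ 5 * (n : ℝ) ^ 2 * ε := by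
        gcongr
        nlinarith
    _ ≤ 1 / n := five_mul_sq_mul_exp_le h.log_large

end Union

/-! ### Averaging over the seed mapping -/

theorem prod_binomialRandom_eq_map {V : Type*} [Finite V] {α : Type*} [MeasurableSpace α]
    (p s : unitInterval) (π : Measure α) [SFinite π] :
    (SimpleGraph.binomialRandom V p).prod
        ((SimpleGraph.binomialRandom V s).prod ((SimpleGraph.binomialRandom V s).prod π))
      = ((graphLaw V p s).prod π).map fun x => (x.1.1, x.1.2.1, x.1.2.2, x.2) := by
  rw [← Measure.prodAssoc_prod (μ := SimpleGraph.binomialRandom V s)]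
  nth_rw 1 [← Measure.map_id (μ := SimpleGraph.binomialRandom V p)]
  rw [Measure.map_prod_map _ _ measurable_id (by fun_prop), ← Measure.prodAssoc_prod,
    Measure.map_map (by fun_prop) (by fun_prop)]
  rfl

instance (n : ℕ) : DiscreteMeasurableSpace (Equiv.Perm (Fin n)) := ⟨fun _ => trivial⟩

/-- By Fubini it suffices to bound the failure probability for each fixed `π` in `seedPerms πstar
β`. -/
theorem le_law_exactRecovery {n : ℕ} (p s : unitInterval) (πstar : Equiv.Perm (Fin n)) {β : ℝ}
    (hne : (seedPerms πstar β).Nonempty)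
    (h : GapBounds (n * β * p * (s : ℝ) ^ 2 * (1 - p)) (n * β * p * (s : ℝ) ^ 2)
      (n * (p : ℝ) ^ 2 * (s : ℝ) ^ 2) (Real.log n)) :
    1 - 1 / (n : ℝ) ≤ (law p s πstar β).real (exactRecovery 1 πstar) := by
  have hfin : (seedPerms πstar β).Finite := Set.toFinite _
  have : IsProbabilityMeasure (uniformOn (seedPerms πstar β)) :=
    isProbabilityMeasure_uniformOn hfin hne
  set bad : Set ((SimpleGraph (Fin n) × SimpleGraph (Fin n) × SimpleGraph (Fin n)) ×
      Equiv.Perm (Fin n)) := {x | ∃ u v, v ≠ u ∧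
        witnessCount x.1 (πstar⁻¹ * x.2) u u ≤ witnessCount x.1 (πstar⁻¹ * x.2) u v}
  have hbad_le : ((graphLaw (Fin n) p s).prod (uniformOn (seedPerms πstar β))) bad
      ≤ ENNReal.ofReal (1 / n) := by
    rw [Measure.prod_apply_symm (Set.toFinite _).measurableSet]
    have hae : ∀ᵐ π ∂(uniformOn (seedPerms πstar β)),
        graphLaw (Fin n) p s ((fun ω => (ω, π)) ⁻¹' bad) ≤ ENNReal.ofReal (1 / n) := by
      filter_upwards [ae_cond_mem hfin.measurableSet] with π hπ
      refine (ENNReal.le_ofReal_iff_toReal_le (measure_ne_top _ _) (by positivity)).2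
        (measureReal_exists_witnessCount_ge (σ := πstar⁻¹ * π) ?_ h)
      -- The fixed points of `πstar⁻¹ * π` are the vertices where `π` and `πstar` agree.
      rw [← hπ]
      simp [Equiv.symm_apply_eq]
    refine (lintegral_mono_ae hae).trans ?_
    simp
  have hsub : badᶜ ⊆ (fun x : (SimpleGraph (Fin n) × SimpleGraph (Fin n) × SimpleGraph (Fin n)) ×
      Equiv.Perm (Fin n) => ((x.1.1, x.1.2.1, x.1.2.2, x.2) : Sample n)) ⁻¹'
        exactRecovery 1 πstar := by
    intro x hx
    refine mem_exactRecovery_of_witnessCount_lt πstar _ fun u v hvu => ?_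
    by_contra hle
    exact hx ⟨u, v, hvu, not_lt.1 hle⟩
  rw [law, prod_binomialRandom_eq_map,
    map_measureReal_apply (by fun_prop) (Set.toFinite _).measurableSet]
  refine le_trans ?_ (measureReal_mono hsub)
  rw [probReal_compl_eq_one_sub (Set.toFinite _).measurableSet]
  exact sub_le_sub_left (ENNReal.toReal_le_of_le_ofReal (by positivity) hbad_le) 1

end SeededMatching

theorem theorem1 :
    ∃ N : ℕ, ∀ n : ℕ, N ≤ n →
      ∀ (p s : unitInterval) (β : ℝ) (πstar : Equiv.Perm (Fin n)),
        0 < p → p < 1 → 0 < s → 0 ≤ β → β < 1 →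
        (SeededMatching.seedPerms πstar β).Nonempty →
        β ≥ max (45 * Real.log n / (n * p * (1 - p : ℝ) ^ 2 * (s : ℝ) ^ 2))
          (30 * Real.sqrt (Real.log n / (n * (1 - p : ℝ) ^ 2 * (s : ℝ) ^ 2))) →
        (SeededMatching.law p s πstar β).real (SeededMatching.exactRecovery 1 πstar)
          ≥ 1 - 1 / (n : ℝ) := by
  -- This threshold is equivalent to `log n ≥ 10`.
  refine ⟨⌈Real.exp 10⌉₊, fun n hn p s β πstar hp hp1 hs hβ0 _ hne hβ => ?_⟩
  have hn' : Real.exp 10 ≤ n := Nat.ceil_le.1 hn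
  have hn0 : (0 : ℝ) < n := (Real.exp_pos _).trans_le hn'
  exact SeededMatching.le_law_exactRecovery p s πstar hne
    (SeededMatching.gapBounds_of_le hn0 hp hp1 hs hβ0 ((Real.le_log_iff_exp_le hn0).2 hn') hβ)
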